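/- Let $G\cong C_{n_1}\oplus C_{n_2}$ be a finite abelian group of rank two, where $2\le n_1\mid n_2$. A sequence over $G$ is a finite multiset of elements of $G$; it is a minimal zero-sum sequence if it is nonempty, has sum $0$, and no proper nonempty subsequence has a nonempty zero-sum subsequence. $\mathsf D(G)$ is the least positive integer $l$ such that every sequence over $G$ of length at least $l$ has a nonempty zero-sum subsequence. A basis $(u,v)$ of $G$ is a pair of nonzero elements that generate $G$ and are independent ($ru+sv=0$ with $r,s\in\mathbb Z$ implies $ru=sv=0$). **(A)** For every integer $k$ with $3\le k\le\min\{n_1+1,\exp(G)\}$ there is a minimal zero-sum sequence over $G$ of length $\mathsf D(G)$ with exactly $k$ distinct terms. **(B)** Let $(u,v)$ be a basis of $G$ with $\{\operatorname{ord}u,\operatorname{ord}v\}=\{n_1,n_2\}$, put $p=\operatorname{ord}u$ and $q=\operatorname{ord}v$, and let $a=(a_1,\dots,a_p)$ be nonnegative integers with $a_1+\dots+a_p=q$. Say that $a$ is realized by $S$ (with respect to $(u,v)$) if $S$ is a minimal zero-sum sequence of length $\mathsf D(G)$ of the form $$S=u^{p-1}\prod_{i=1}^{p}(x_iu+v)^{a_i},\qquad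 x_1,\dots,x_p\in\{0,\dots,p-1\}\text{ pairwise distinct,}$$ and that $a$ is realizable if it is realized by some $S$. (Thus the multiplicities of the distinct terms of $S$ are $p-1$ and the positive $a_i$.) Let $g=\gcd(a_1,\dots,a_p,p)$ and $d=\gcd(a_2-a_1,\dots,a_p-a_1,p)$. 1. If $n_1=n_2$ (so $p=q=n_1$): $a$ is realizable if and only if either $n_1=2$ and all $a_i=1$, or some $a_i=0$ and $g=1$. The numbers of distinct terms of the sequences $S$ that realize some such $a$ are exactly the integers $k\in[3,n_1]$, together with $k=n_1+1=3$ if $n_1=2$. 2. If $n_1<n_2$, $p=n_2$ and $q=n_1$: $a$ is realizable if and only if $g=1$. The numbers of distinct terms of the sequences $S$ that realize some such $a$ are exactly the integers $k\in[3,n_1+1]$. 3. If $n_1<n_2$, $p=n_1$ and $q=n_2$: if $n_1=2$, then $a$ is realizable if and only if $a_1$ and $a_2$ are both odd; if $n_1\ge3$, then $a$ is realizable if and only if either ($n_1$ is odd or some $a_i$ is even) and $d=1$, or $n_1\equiv2\pmod 4$, all $a_i$ are odd, and $d=2$. The numbers of distinct terms of the sequences $S$ that realize some such $a$ are exactly the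 integers $k\in[3,n_1+1]$. -/

import Mathlib

/-- Finite unordered sequences over `G` are multisets; a subsequence of `S` is a `T ≤ S`.
`S` is zero-sum free if it has no non-trivial zero-sum subsequence. -/
def IsZeroSumFree {G : Type*} [AddCommGroup G] (S : Multiset G) : Prop :=
  ∀ T : Multiset G, T ≤ S → T ≠ 0 → T.sum ≠ 0

/-- Minimal zero-sum sequences: non-empty, with sum zero, and every proper non-empty
subsequence is zero-sum free. -/
def IsMinimalZeroSum {G : Type*} [AddCommGroup G] (S : Multiset G) : Prop :=
  0 < S.card ∧ S.sum = 0 ∧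
    ∀ T : Multiset G, T ≤ S → 0 < T.card → T.card < S.card → IsZeroSumFree T

/-- The Davenport constant: the smallest positive `l` such that every sequence of length
at least `l` has a non-trivial zero-sum subsequence. -/
noncomputable def davenportConstant (G : Type*) [AddCommGroup G] : ℕ :=
  sInf {l : ℕ | 0 < l ∧ ∀ S : Multiset G, l ≤ S.card → ¬ IsZeroSumFree S}

/-- `(u, v)` is a basis of the abelian group `G`: both elements are non-zero, they are
independent, and they generate `G`. -/
def IsBasisPair {G : Type*} [AddCommGroup G] (u v : G) : Prop :=
  u ≠ 0 ∧ v ≠ 0 ∧ (∀ r s : ℤ, r • u + s • v = 0 → r • u = 0 ∧ s • v = 0) ∧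
    AddSubgroup.closure {u, v} = ⊤

/-- `S` is a minimal zero-sum sequence of maximal length `D(G)` of the shape
`u ^ (ord u - 1) * ∏ i, (x i • u + v) ^ (a i)` with distinct `x i ∈ [0, ord u - 1]`.
Indices with `a i = 0` contribute nothing, so the multiplicity pattern of `S` is `ord u - 1`
together with the positive `a i`. -/
def RealizesPattern {G : Type*} [AddCommGroup G] (u v : G) {p : ℕ} (a : Fin p → ℕ)
    (S : Multiset G) : Prop :=
  IsMinimalZeroSum S ∧ S.card = davenportConstant G ∧
    ∃ x : Fin p → ℕ, Function.Injective x ∧ (∀ i, x i < addOrderOf u) ∧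
      S = Multiset.replicate (addOrderOf u - 1) u +
        ∑ i, Multiset.replicate (a i) (x i • u + v)

/-- `gcd(a_1, …, a_p, p)`. -/
def patternGcd {p : ℕ} (a : Fin p → ℕ) : ℕ :=
  Nat.gcd (Finset.univ.gcd a) p

/-- The greatest common divisor of `p` and all differences `a_i - a_j`, which is the same as
`gcd(a_2 - a_1, …, a_p - a_1, p)`. -/
def patternDiffGcd {p : ℕ} (a : Fin p → ℕ) : ℕ :=
  Nat.gcd (Finset.univ.gcd fun q : Fin p × Fin p => ((a q.1 : ℤ) - (a q.2 : ℤ)).natAbs) p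

/-! Write `p = ord u`, `q = ord v`. The sum of `S` is `(p - 1 + ∑ a i * x i) • u + q • v`, so it
vanishes iff `∑ a i * x i ≡ 1` mod `p`. Minimality is then automatic: by independence a zero-sum
subsequence uses a multiple of `q` of the terms in `⟨u⟩ + v`, hence none or all, and the copies of
`u` are too few to sum to zero. With `D(G) = n₁ + n₂ - 1` (Olson), realizability becomes
`HasUnitWeighting a`. The `x i` run through all residues, and scaling by a unit permutes these, so
it suffices that some rearrangement makes `∑ a (σ i) * i` coprime to `p`.

The core is `exists_perm_sum_mul_not_dvd`: non-constancy modulo each prime suffices for all of them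
at once. Split off the smallest prime, `n = s * m` with `s = ℓ ^ e`, and write indices as `y + m *
k`. Modulo the other primes only column sums weighted by `y` count, which is the same problem on `m`
columns; a swap inside a column repairs `ℓ` without changing the sum modulo `m`.
`exists_perm_columns` prepares the array, by pigeonhole on swaps.

If `a` is constant modulo a prime dividing `p`, the weighted sum is a constant times `p * (p - 1) /
2`, so only the prime `2` can be harmless, when the entries are odd and `p ≡ 2` mod `4`. The support
sizes follow from explicit patterns. -/

/-! ### Exchanging entries between columns of an array -/

section ColumnSwaps

variable {K M : Type*} [Fintype K] [DecidableEq K] [DecidableEq M]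

/-- Column sums after exchanging two entries lying in different columns. -/
lemma sum_comp_swap (g : K × M → ℤ) (k₀ k₁ : K) {y₀ y₁ : M} (h : y₀ ≠ y₁) (w : M) :
    ∑ k, g (Equiv.swap (k₀, y₀) (k₁, y₁) (k, w)) =
      (∑ k, g (k, w)) + (if w = y₀ then g (k₁, y₁) - g (k₀, y₀) else 0)
        + (if w = y₁ then g (k₀, y₀) - g (k₁, y₁) else 0) := by
  have key : ∀ k, g (Equiv.swap (k₀, y₀) (k₁, y₁) (k, w)) = g (k, w)
      + (if k = k₀ then (if w = y₀ then g (k₁, y₁) - g (k₀, y₀) else 0) else 0)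
      + (if k = k₁ then (if w = y₁ then g (k₀, y₀) - g (k₁, y₁) else 0) else 0) := by
    intro k
    rw [Equiv.swap_apply_def]
    by_cases h0 : w = y₀
    · subst h0
      by_cases hk : k = k₀ <;> simp [h, hk]
    · by_cases h1 : w = y₁
      · subst h1
        by_cases hk : k = k₁ <;> simp [h0, hk]
      · simp [h0, h1]
  simp only [key, Finset.sum_add_distrib, Finset.sum_ite_eq', Finset.mem_univ, if_true]

variable [Fintype M]

/-- Two exchanges with a common column cannot both make all column sums congruent, unless
they already are. -/
lemma columnSums_const_of_two_swaps {p : ℕ} (hM : 4 ≤ Fintype.card M) (g : K × M → ℤ)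
    {y₀ y₁ y₂ : M} (h01 : y₀ ≠ y₁) (h02 : y₀ ≠ y₂) (h12 : y₁ ≠ y₂) (k₁ k₁' k₂ k₂' : K)
    (H₁ : ∀ w w', ∑ k, g (Equiv.swap (k₁, y₀) (k₁', y₁) (k, w)) ≡
      ∑ k, g (Equiv.swap (k₁, y₀) (k₁', y₁) (k, w')) [ZMOD p])
    (H₂ : ∀ w w', ∑ k, g (Equiv.swap (k₂, y₀) (k₂', y₂) (k, w)) ≡
      ∑ k, g (Equiv.swap (k₂, y₀) (k₂', y₂) (k, w')) [ZMOD p]) (w w' : M) :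
    ∑ k, g (k, w) ≡ ∑ k, g (k, w') [ZMOD p] := by
  simp only [sum_comp_swap g _ _ h01] at H₁
  simp only [sum_comp_swap g _ _ h02] at H₂
  obtain ⟨y, hy⟩ : ∃ y, y ∉ ({y₀, y₁, y₂} : Finset M) := by
    by_contra! hc
    have := Finset.card_le_card (fun x _ => hc x : (Finset.univ : Finset M) ⊆ _)
    have h3 := Finset.card_le_three (a := y₀) (b := y₁) (c := y₂)
    rw [Finset.card_univ] at this
    omega
  simp only [Finset.mem_insert, Finset.mem_singleton, not_or] at hy
  obtain ⟨hy0, hy1, hy2⟩ := hy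
  set S : M → ℤ := fun w => ∑ k, g (k, w) with hS
  have a1 : S y₁ ≡ S y [ZMOD p] := by
    simpa [hy0, hy1, hy2, h01.symm, h12, h02.symm, hS] using H₂ y₁ y
  have a0 : S y₀ ≡ S y [ZMOD p] := by
    have e1 := H₁ y₁ y
    have e0 := H₁ y₀ y
    simp only [hy0, hy1, h01, h01.symm, if_true, if_false, add_zero] at e0 e1
    -- The two changes caused by the exchange cancel, so `S y₀ + S y₁ ≡ 2 * S y`.
    have e2 := (e0.add e1).sub a1
    ring_nf at e2
    have : S y₀ ≡ S y [ZMOD p] := by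
      convert e2 using 1 <;> simp only [hS] <;> ring
    exact this
  have all : ∀ w, S w ≡ S y [ZMOD p] := by
    intro w
    by_cases h0 : w = y₀
    · rw [h0]; exact a0
    by_cases h1 : w = y₁
    · rw [h1]; exact a1
    simpa [hy0, hy1, h0, h1, hS] using H₁ w y
  exact (all w).trans (all w').symm

omit [Fintype M] in
/-- Two exchanges with a common column cannot both make every column constant, unless every
column already is. -/
lemma columns_const_of_two_swaps {p : ℕ} (hK : 2 ≤ Fintype.card K) (g : K × M → ℤ)
    {y₀ y₁ y₂ : M} (h01 : y₀ ≠ y₁) (h02 : y₀ ≠ y₂) (h12 : y₁ ≠ y₂) (k₁ k₁' k₂ k₂' : K)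
    (H₁ : ∀ w k k', g (Equiv.swap (k₁, y₀) (k₁', y₁) (k, w)) ≡
      g (Equiv.swap (k₁, y₀) (k₁', y₁) (k', w)) [ZMOD p])
    (H₂ : ∀ w k k', g (Equiv.swap (k₂, y₀) (k₂', y₂) (k, w)) ≡
      g (Equiv.swap (k₂, y₀) (k₂', y₂) (k', w)) [ZMOD p]) (w : M) (k k' : K) :
    g (k, w) ≡ g (k', w) [ZMOD p] := by
  have hne : ∀ (i j : K × M) (k : K) (w : M), w ≠ i.2 → w ≠ j.2 → Equiv.swap i j (k, w) = (k, w) := by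
    intro i j k w hi hj
    apply Equiv.swap_apply_of_ne_of_ne <;> rintro rfl <;> simp at hi hj
  by_cases h1 : w = y₁
  · subst h1
    simpa only [hne (k₂, y₀) (k₂', y₂) _ w h01.symm h12] using H₂ w k k'
  by_cases h0 : w = y₀
  · subst h0
    have c1 : ∀ k k', g (k, y₁) ≡ g (k', y₁) [ZMOD p] := by
      intro k k'
      simpa only [hne (k₂, w) (k₂', y₂) _ y₁ h01.symm h12] using H₂ y₁ k k'
    -- A second row keeps an original entry of column `y₁` there after the first exchange, which
    -- ties the imported entry to that column's constant.
    have : Nontrivial K := Fintype.one_lt_card_iff_nontrivial.1 hK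
    obtain ⟨j, hj⟩ := exists_ne k₁'
    have e1 : g (k₁, w) ≡ g (k₁', y₁) [ZMOD p] := by
      have e := H₁ y₁ k₁' j
      rw [Equiv.swap_apply_right, Equiv.swap_apply_of_ne_of_ne (by simp [h01.symm]) (by simp [hj])] at e
      exact e.trans (c1 _ _)
    have all : ∀ k, g (k, w) ≡ g (k₁', y₁) [ZMOD p] := by
      intro k
      by_cases hk : k = k₁
      · rw [hk]; exact e1
      have e := H₁ w k k₁
      rwa [Equiv.swap_apply_left, Equiv.swap_apply_of_ne_of_ne (by simp [hk]) (by simp [h01])] at e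
    exact (all k).trans (all k').symm
  · simpa only [hne (k₁, y₀) (k₁', y₁) _ w h0 h1] using H₁ w k k'

omit [Fintype M] in
lemma exists_perm_column_nonconst {p : ℕ} (hK : 2 ≤ Fintype.card K) (f : K × M → ℤ)
    (hf : ∃ i j, ¬ f i ≡ f j [ZMOD p]) :
    ∃ σ : Equiv.Perm (K × M), ∃ y k k', ¬ f (σ (k, y)) ≡ f (σ (k', y)) [ZMOD p] := by
  obtain ⟨⟨k, y⟩, ⟨k', y'⟩, h⟩ := hf
  by_cases hy : y = y'
  · subst hy
    exact ⟨1, y, k, k', h⟩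
  have : Nontrivial K := Fintype.one_lt_card_iff_nontrivial.1 hK
  obtain ⟨j, hj⟩ := exists_ne k'
  refine ⟨Equiv.swap (k, y) (j, y'), y', j, k', ?_⟩
  rwa [Equiv.swap_apply_right,
    Equiv.swap_apply_of_ne_of_ne (by simp [Ne.symm hy]) (by simp [hj.symm])]

omit [DecidableEq K] [DecidableEq M] in
/-- If all column sums are congruent modulo `p` but the entries are not, then some column is
not constant modulo `p`, provided `p` is coprime to the number of rows. -/
lemma exists_column_nonconst {p : ℕ} (hp : Nat.Coprime p (Fintype.card K)) (g : K × M → ℤ)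
    (hg : ∃ i j, ¬ g i ≡ g j [ZMOD p])
    (hS : ∀ w w', ∑ k, g (k, w) ≡ ∑ k, g (k, w') [ZMOD p]) :
    ∃ y k k', ¬ g (k, y) ≡ g (k', y) [ZMOD p] := by
  by_contra! hc
  obtain ⟨⟨k, y⟩, ⟨k', y'⟩, h⟩ := hg
  apply h
  -- For constant columns each sum is `card K` times an entry, and `card K` is invertible modulo
  -- `p`.
  have hsum : ∀ k w, ∑ j, g (j, w) ≡ (Fintype.card K : ℤ) * g (k, w) [ZMOD p] := by
    intro k w
    have : (Fintype.card K : ℤ) * g (k, w) = ∑ _j : K, g (k, w) := by simp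
    rw [this]
    exact Int.ModEq.sum fun j _ => hc w j k
  have e := ((hsum k y).symm.trans (hS y y')).trans (hsum k' y')
  rw [Int.modEq_iff_dvd, ← mul_sub] at e
  exact Int.modEq_iff_dvd.2 ((Nat.isCoprime_iff_coprime.2 hp).dvd_of_dvd_mul_left e)

/-- A finite array can be rearranged so that some column is non-constant modulo `ℓ` and, for
each `p` in `T`, the column sums are not all congruent modulo `p`. -/
lemma exists_perm_columns {ℓ : ℕ} (hK : 2 ≤ Fintype.card K) (f : K × M → ℤ)
    (hℓ : ∃ i j, ¬ f i ≡ f j [ZMOD ℓ]) (T : Finset ℕ)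
    (hT : ∀ p ∈ T, Nat.Coprime p (Fintype.card K))
    (hf : ∀ p ∈ T, ∃ i j, ¬ f i ≡ f j [ZMOD p])
    (hM : T.Nonempty → T.card + 2 ≤ Fintype.card M) :
    ∃ σ : Equiv.Perm (K × M), (∃ y k k', ¬ f (σ (k, y)) ≡ f (σ (k', y)) [ZMOD ℓ]) ∧
      ∀ p ∈ T, ∃ w w', ¬ ∑ k, f (σ (k, w)) ≡ ∑ k, f (σ (k, w')) [ZMOD p] := by
  induction T using Finset.induction_on with
  | empty =>
    obtain ⟨σ, h⟩ := exists_perm_column_nonconst hK f hℓ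
    exact ⟨σ, h, by simp⟩
  | insert p T hpT ih =>
    have hM := hM (Finset.insert_nonempty _ _)
    rw [Finset.card_insert_of_notMem hpT] at hM
    obtain ⟨σ, h1, h2⟩ := ih (fun q hq => hT q (Finset.mem_insert_of_mem hq))
      (fun q hq => hf q (Finset.mem_insert_of_mem hq)) (fun _ => by omega)
    by_cases hp : ∃ w w', ¬ ∑ k, f (σ (k, w)) ≡ ∑ k, f (σ (k, w')) [ZMOD p]
    · exact ⟨σ, h1, fun q hq => (Finset.mem_insert.1 hq).elim (fun e => e ▸ hp) (h2 q)⟩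
    push Not at hp
    set g : K × M → ℤ := fun i => f (σ i) with hg
    obtain ⟨y₀, k₀, k₀', hk⟩ := exists_column_nonconst (hT p (Finset.mem_insert_self _ _)) g
      (by
        obtain ⟨i, j, h⟩ := hf p (Finset.mem_insert_self _ _)
        exact ⟨σ.symm i, σ.symm j, by simpa [hg] using h⟩) hp
    -- Column `y₀` takes two values modulo `p`, so for any `y` one of its entries differs from the
    -- one to be exchanged with it; that exchange breaks the equality of column sums modulo `p`.
    have hchoose : ∀ y, ∃ k, ¬ g (k, y₀) ≡ g (k₀, y) [ZMOD p] := by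
      intro y
      by_contra! hc
      exact hk ((hc k₀).trans (hc k₀').symm)
    choose c hc using hchoose
    by_contra! hcon
    have hpgood : ∀ y, y₀ ≠ y → ∃ w w',
        ¬ ∑ k, g (Equiv.swap (c y, y₀) (k₀, y) (k, w)) ≡
          ∑ k, g (Equiv.swap (c y, y₀) (k₀, y) (k, w')) [ZMOD p] := by
      intro y hy
      obtain ⟨w, hw⟩ : ∃ w, w ∉ ({y₀, y} : Finset M) := by
        by_contra! h
        have h' := Finset.card_le_card (fun x _ => h x : (Finset.univ : Finset M) ⊆ _)
        have h3 := Finset.card_le_two (a := y₀) (b := y)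
        rw [Finset.card_univ] at h'
        omega
      simp only [Finset.mem_insert, Finset.mem_singleton, not_or] at hw
      refine ⟨y₀, w, fun h => hc y ?_⟩
      simp only [sum_comp_swap g _ _ hy, hw, hy, if_true, if_false, add_zero] at h
      have hp' : ∑ k, g (k, y₀) ≡ ∑ k, g (k, w) [ZMOD p] := hp y₀ w
      have h3 := h.sub hp'
      rw [add_sub_cancel_left, sub_self] at h3
      simpa using (h3.add_right (g (c y, y₀))).symm
    have hbad : ∀ y, y₀ ≠ y → ∃ o ∈ Finset.insertNone T, match o with
        | none => ∀ w k k', g (Equiv.swap (c y, y₀) (k₀, y) (k, w)) ≡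
            g (Equiv.swap (c y, y₀) (k₀, y) (k', w)) [ZMOD ℓ]
        | some q => ∀ w w', ∑ k, g (Equiv.swap (c y, y₀) (k₀, y) (k, w)) ≡
          ∑ k, g (Equiv.swap (c y, y₀) (k₀, y) (k, w')) [ZMOD q] := by
      intro y hy
      by_cases hl : ∃ w k k', ¬ g (Equiv.swap (c y, y₀) (k₀, y) (k, w)) ≡
            g (Equiv.swap (c y, y₀) (k₀, y) (k', w)) [ZMOD ℓ]
      · obtain ⟨q, hq, h⟩ := hcon (σ * Equiv.swap (c y, y₀) (k₀, y)) hl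
        rcases Finset.mem_insert.1 hq with rfl | hq
        · obtain ⟨w, w', h'⟩ := hpgood y hy
          exact absurd (h w w') h'
        · exact ⟨some q, by simpa using hq, h⟩
      · push Not at hl
        exact ⟨none, by simp, hl⟩
    -- `κ y` records what the exchange with column `y` spoils: the column condition at `ℓ`, or a
    -- prime of `T`. There are `card M - 1 ≥ T.card + 2` choices of `y` and `T.card + 1`
    -- obstructions, so two exchanges spoil the same one.
    choose! κ hκ hκ' using hbad
    obtain ⟨y₁, hy1, y₂, hy2, hne, heq⟩ := Finset.exists_ne_map_eq_of_card_lt_of_maps_to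
      (s := Finset.univ.erase y₀) (t := Finset.insertNone T) (f := κ)
      (by rw [Finset.card_erase_of_mem (Finset.mem_univ _), Finset.card_insertNone,
            Finset.card_univ]; omega)
      (fun y hy => hκ y (Finset.ne_of_mem_erase hy).symm)
    have h01 := (Finset.ne_of_mem_erase hy1).symm
    have h02 := (Finset.ne_of_mem_erase hy2).symm
    have b1 := hκ' y₁ h01
    have b2 := hκ' y₂ h02
    have b0 := hκ y₁ h01
    rw [← heq] at b2
    cases hk : κ y₁ with
    | none =>
      rw [hk] at b1 b2
      obtain ⟨y, k, k', h⟩ := h1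
      exact h (columns_const_of_two_swaps hK g h01 h02 hne _ _ _ _ b1 b2 y k k')
    | some q =>
      rw [hk] at b1 b2 b0
      have hq : q ∈ T := by simpa using b0
      obtain ⟨w, w', h⟩ := h2 q hq
      have : 0 < T.card := Finset.card_pos.2 ⟨q, hq⟩
      exact h (columnSums_const_of_two_swaps (by omega) g h01 h02 hne _ _ _ _ b1 b2 w w')

end ColumnSwaps

/-! ### Rearrangements with weighted sum prime to `n` -/

lemma sum_comp_swap_mul {ι : Type*} [Fintype ι] [DecidableEq ι] (g w : ι → ℤ) {i j : ι}
    (hij : i ≠ j) :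
    ∑ x, g (Equiv.swap i j x) * w x = ∑ x, g x * w x + (g j - g i) * (w i - w j) := by
  have key : ∀ x, g (Equiv.swap i j x) * w x = g x * w x
      + (if x = i then (g j - g i) * w i else 0) + (if x = j then (g i - g j) * w j else 0) := by
    intro x
    rw [Equiv.swap_apply_def]
    by_cases hi : x = i
    · subst hi
      simp only [if_true, hij, if_false]
      ring
    · by_cases hj : x = j
      · subst hj
        simp only [if_true, hij.symm, if_false]
        ring
      · simp [hi, hj]
  simp only [key, Finset.sum_add_distrib, Finset.sum_ite_eq', Finset.mem_univ, if_true]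
  ring

/-- The product of the primes divides `m` and is at least `3 ^ Q.card`. This supplies the columns
for the pigeonhole; it fails for `Q = {2}`, which is why the smallest prime is split off. -/
lemma card_add_two_le_of_primes_dvd {Q : Finset ℕ} {m : ℕ} (hm : 0 < m) (hQ : Q.Nonempty)
    (hp : ∀ p ∈ Q, p.Prime) (h3 : ∀ p ∈ Q, 3 ≤ p) (hd : ∀ p ∈ Q, p ∣ m) : Q.card + 2 ≤ m := by
  have h1 : ∏ p ∈ Q, p ∣ m := Finset.prod_primes_dvd m (fun p h => (hp p h).prime) hd
  have h2 : 3 ^ Q.card ≤ ∏ p ∈ Q, p := Finset.pow_card_le_prod Q _ 3 h3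
  have h4 : ∀ k : ℕ, 1 ≤ k → k + 2 ≤ 3 ^ k := by
    intro k hk
    induction k, hk using Nat.le_induction with
    | base => norm_num
    | succ k _ ih => rw [pow_succ]; omega
  exact (h4 _ (Finset.card_pos.2 hQ)).trans (h2.trans (Nat.le_of_dvd hm h1))

/-- If some column of `g` is not constant modulo the prime `ℓ`, then after possibly exchanging
two entries of that column the weighted sum of `g` is not divisible by `ℓ`, while its class modulo
`m` is unchanged. -/
lemma exists_swap_not_dvd {ℓ s m : ℕ} (hℓ : ℓ.Prime) (hs : ℓ ∣ s) (hs0 : 0 < s) (hm : ¬ ℓ ∣ m)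
    (g : Fin s × Fin m → ℤ) (hg : ∃ y k k', ¬ g (k, y) ≡ g (k', y) [ZMOD ℓ]) :
    ∃ ρ : Equiv.Perm (Fin s × Fin m),
      ¬ (ℓ : ℤ) ∣ ∑ x, g (ρ x) * ((x.2 : ℕ) + m * (x.1 : ℕ) : ℤ) ∧
      ∑ x, g (ρ x) * ((x.2 : ℕ) + m * (x.1 : ℕ) : ℤ) ≡
        ∑ x, g x * ((x.2 : ℕ) + m * (x.1 : ℕ) : ℤ) [ZMOD m] := by
  by_cases h : (ℓ : ℤ) ∣ ∑ x, g x * ((x.2 : ℕ) + m * (x.1 : ℕ) : ℤ)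
  swap
  · exact ⟨1, h, Int.ModEq.refl _⟩
  have hℓs := Nat.le_of_dvd hs0 hs
  have h2 := hℓ.two_le
  -- The swap changes the sum by `(g (k', y) - g (k, y)) * m * (k - k')`, so the row indices must
  -- differ modulo `ℓ` too. If they do not, a row `j` in another class can replace one of them.
  obtain ⟨y, k, k', hne, hlt⟩ : ∃ y k k', ¬ g (k, y) ≡ g (k', y) [ZMOD ℓ] ∧
      ¬ ((k : ℕ) : ℤ) ≡ ((k' : ℕ) : ℤ) [ZMOD ℓ] := by
    obtain ⟨y, k, k', hk⟩ := hg
    refine ⟨y, ?_⟩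
    by_contra! hc
    have hkk : ((k : ℕ) : ℤ) ≡ ((k' : ℕ) : ℤ) [ZMOD ℓ] := hc k k' hk
    obtain ⟨j, hj⟩ : ∃ j : Fin s, ¬ ((k : ℕ) : ℤ) ≡ ((j : ℕ) : ℤ) [ZMOD ℓ] := by
      by_contra! hall
      have h0 := hall ⟨0, by omega⟩
      have h1 := hall ⟨1, by omega⟩
      have h01 := h0.symm.trans h1
      have := Int.modEq_iff_dvd.1 h01
      norm_num at this
      have := Int.eq_one_of_dvd_one (by positivity) this
      omega
    have e1 : g (k, y) ≡ g (j, y) [ZMOD ℓ] := by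
      by_contra h'
      exact hj (hc k j h')
    have e2 : g (k', y) ≡ g (j, y) [ZMOD ℓ] := by
      by_contra h'
      exact hj (hkk.trans (hc k' j h'))
    exact hk (e1.trans e2.symm)
  have hkne : ((k, y) : Fin s × Fin m) ≠ (k', y) := by
    intro e
    rw [Prod.mk.injEq] at e
    exact hlt (by rw [e.1])
  have hℓ' : Prime (ℓ : ℤ) := Nat.prime_iff_prime_int.1 hℓ
  refine ⟨Equiv.swap (k, y) (k', y), ?_, ?_⟩
  · rw [sum_comp_swap_mul g (fun x => ((x.2 : ℕ) + m * (x.1 : ℕ) : ℤ)) hkne, dvd_add_right h]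
    simp only [add_sub_add_left_eq_sub, ← mul_sub]
    rw [hℓ'.dvd_mul, hℓ'.dvd_mul, Int.natCast_dvd_natCast]
    rintro (h' | h' | h')
    · exact hne (Int.modEq_iff_dvd.2 h')
    · exact hm h'
    · exact hlt (Int.modEq_iff_dvd.2 h').symm
  · rw [sum_comp_swap_mul g (fun x => ((x.2 : ℕ) + m * (x.1 : ℕ) : ℤ)) hkne]
    simp only [add_sub_add_left_eq_sub, ← mul_sub]
    refine (Int.modEq_iff_dvd.2 ?_)
    rw [sub_add_cancel_left, dvd_neg]
    exact Dvd.dvd.mul_left (dvd_mul_right _ _) _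

/-- If `a` is non-constant modulo each of the primes `p ∈ Q`, all dividing `n`, then for some
rearrangement of `a` the sum `∑ i, a i * i` is divisible by no prime in `Q`. -/
theorem exists_perm_sum_mul_not_dvd (Q : Finset ℕ) (hQ : ∀ p ∈ Q, p.Prime) :
    ∀ n : ℕ, 0 < n → (∀ p ∈ Q, p ∣ n) → ∀ a : Fin n → ℤ,
      (∀ p ∈ Q, ∃ i j, ¬ a i ≡ a j [ZMOD p]) →
      ∃ σ : Equiv.Perm (Fin n), ∀ p ∈ Q, ¬ (p : ℤ) ∣ ∑ i, a (σ i) * ((i : ℕ) : ℤ) := by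
  induction Q using Finset.induction_on_min with
  | empty => intro n _ _ a _; exact ⟨1, by simp⟩
  | insert ℓ Q hlt ih =>
    intro n hn hdvd a ha
    have hℓ : ℓ.Prime := hQ ℓ (Finset.mem_insert_self _ _)
    have hQp : ∀ p ∈ Q, p.Prime := fun p hp => hQ p (Finset.mem_insert_of_mem hp)
    obtain ⟨e, m, hm, rfl⟩ := Nat.exists_eq_pow_mul_and_not_dvd hn.ne' ℓ hℓ.ne_one
    have he : e ≠ 0 := by
      rintro rfl
      exact hm (by simpa using hdvd ℓ (Finset.mem_insert_self _ _))
    have hcop : ∀ p ∈ Q, Nat.Coprime p (ℓ ^ e) := fun p hp =>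
      Nat.Coprime.pow_right e ((Nat.coprime_primes (hQp p hp) hℓ).2 (hlt p hp).ne')
    have hs : ℓ ∣ ℓ ^ e := dvd_pow_self ℓ he
    generalize ℓ ^ e = s at *
    have hs0 : 0 < s := Nat.pos_of_mul_pos_right hn
    have hm0 : 0 < m := Nat.pos_of_mul_pos_left hn
    have hdm : ∀ p ∈ Q, p ∣ m := fun p hp =>
      (hcop p hp).dvd_of_dvd_mul_left (hdvd p (Finset.mem_insert_of_mem hp))
    set f : Fin s × Fin m → ℤ := fun x => a (finProdFinEquiv x) with hf
    have hfne : ∀ p ∈ insert ℓ Q, ∃ i j, ¬ f i ≡ f j [ZMOD p] := by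
      intro p hp
      obtain ⟨i, j, h⟩ := ha p hp
      exact ⟨finProdFinEquiv.symm i, finProdFinEquiv.symm j, by
        simpa only [hf, Equiv.apply_symm_apply] using h⟩
    suffices H : ∃ ρ : Equiv.Perm (Fin s × Fin m), ∀ p ∈ insert ℓ Q,
        ¬ (p : ℤ) ∣ ∑ x, f (ρ x) * ((x.2 : ℕ) + m * (x.1 : ℕ) : ℤ) by
      obtain ⟨ρ, h⟩ := H
      refine ⟨(finProdFinEquiv.symm.trans ρ).trans finProdFinEquiv, fun p hp => ?_⟩
      rw [← Equiv.sum_comp finProdFinEquiv]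
      convert h p hp using 3 with x
      simp only [hf, Equiv.trans_apply, Equiv.symm_apply_apply]
      simp [finProdFinEquiv]
    obtain ⟨σ, hσ, hσQ⟩ := exists_perm_columns (ℓ := ℓ)
      (by simpa using hℓ.two_le.trans (Nat.le_of_dvd hs0 hs)) f
      (hfne ℓ (Finset.mem_insert_self _ _)) Q (by simpa using hcop)
      (fun p hp => hfne p (Finset.mem_insert_of_mem hp))
      (fun hne => by
        simpa using card_add_two_le_of_primes_dvd hm0 hne hQp
          (fun p hp => by have := hlt p hp; have := hℓ.two_le; omega) hdm)
    -- `τ` permutes whole columns, so the non-constant column modulo `ℓ` survives.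
    obtain ⟨τ, hτ⟩ := ih hQp m hm0 hdm (fun y => ∑ z, f (σ (z, y))) hσQ
    obtain ⟨ρ, hρ, hρm⟩ := exists_swap_not_dvd hℓ hs hs0 hm (fun x => f (σ (x.1, τ x.2)))
      (by
        obtain ⟨y, k, k', h⟩ := hσ
        exact ⟨τ.symm y, k, k', by simpa using h⟩)
    refine ⟨(ρ.trans (Equiv.prodCongr (Equiv.refl _) τ)).trans σ, fun p hp => ?_⟩
    rcases Finset.mem_insert.1 hp with rfl | hp
    · exact hρ
    · intro hdiv
      apply hτ p hp
      have hpm : (p : ℤ) ∣ m := Int.natCast_dvd_natCast.2 (hdm p hp)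
      have h1 := (Int.ModEq.dvd_iff (hρm.of_dvd hpm)).1 hdiv
      have h2 : ∑ x : Fin s × Fin m, f (σ (x.1, τ x.2)) * ((x.2 : ℕ) + m * (x.1 : ℕ) : ℤ) =
          ∑ y, (∑ z, f (σ (z, τ y))) * ((y : ℕ) : ℤ)
            + m * ∑ x : Fin s × Fin m, f (σ (x.1, τ x.2)) * ((x.1 : ℕ) : ℤ) := by
        rw [Finset.mul_sum, Fintype.sum_prod_type_right, Fintype.sum_prod_type_right,
          ← Finset.sum_add_distrib]
        refine Finset.sum_congr rfl fun y _ => ?_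
        rw [Finset.sum_mul, ← Finset.sum_add_distrib]
        refine Finset.sum_congr rfl fun z _ => ?_
        ring
      rw [h2] at h1
      exact (dvd_add_left (hpm.mul_right _)).1 h1

/-- A weighted sum over a rearrangement that is coprime to `n` can be scaled to be `1` modulo `n`. -/
lemma exists_injective_sum_modEq_one {n : ℕ} (hn : 2 ≤ n) (a : Fin n → ℕ)
    (σ : Equiv.Perm (Fin n))
    (h : ∀ p : ℕ, p.Prime → p ∣ n → ¬ p ∣ ∑ i, a (σ i) * (i : ℕ)) :
    ∃ x : Fin n → ℕ, Function.Injective x ∧ (∀ i, x i < n) ∧ ∑ i, a i * x i ≡ 1 [MOD n] := by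
  have hcop : Nat.Coprime (∑ i, a (σ i) * (i : ℕ)) n :=
    Nat.Coprime.symm (Nat.coprime_of_dvd fun p hp hpn => h p hp hpn)
  obtain ⟨c, -, hc⟩ := Nat.exists_mul_mod_eq_one_of_coprime hcop hn
  have hcn : Nat.Coprime n c := (Nat.coprime_of_mul_modEq_one (∑ i, a (σ i) * (i : ℕ)) (by
    rw [mul_comm, Nat.ModEq, hc, Nat.mod_eq_of_lt hn])).symm
  refine ⟨fun i => c * (σ.symm i : ℕ) % n, fun i j hij => ?_, fun i => Nat.mod_lt _ (by omega), ?_⟩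
  · have h1 : c * (σ.symm i : ℕ) ≡ c * (σ.symm j : ℕ) [MOD n] := hij
    have h2 := Nat.ModEq.cancel_left_of_coprime hcn h1
    have h3 := h2.eq_of_lt_of_lt (σ.symm i).2 (σ.symm j).2
    exact σ.symm.injective (Fin.ext h3)
  · have e : ∑ i, a (σ i) * (i : ℕ) = ∑ i, a i * (σ.symm i : ℕ) := by
      rw [← Equiv.sum_comp σ (fun i => a i * (σ.symm i : ℕ))]
      simp
    have h1 : ∑ i, a i * (c * (σ.symm i : ℕ) % n) ≡ ∑ i, a i * (c * (σ.symm i : ℕ)) [MOD n] :=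
      Nat.ModEq.sum fun i _ => (Nat.mod_modEq _ _).mul_left _
    refine h1.trans ?_
    have h2 : ∑ i, a i * (c * (σ.symm i : ℕ)) = (∑ i, a (σ i) * (i : ℕ)) * c := by
      rw [e, Finset.sum_mul]
      exact Finset.sum_congr rfl fun i _ => by ring
    rw [h2, Nat.ModEq, hc, Nat.mod_eq_of_lt hn]

/-! ### Zero-sum subfamilies in rank two -/

/-- `card κ * (p - 1) + 1` vectors with `card κ` coordinates have a nonempty subfamily whose sum
vanishes modulo the prime `p`. -/
lemma exists_subset_sum_dvd_of_prime {ι κ : Type*} [Fintype κ] {p : ℕ} (hp : p.Prime)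
    (s : Finset ι) (f : κ → ι → ℤ) (h : Fintype.card κ * (p - 1) < s.card) :
    ∃ t ⊆ s, t.Nonempty ∧ ∀ j, (p : ℤ) ∣ ∑ i ∈ t, f j i := by
  classical
  have : Fact p.Prime := ⟨hp⟩
  -- Chevalley–Warning gives a zero other than the trivial one; by Fermat `X ^ (p - 1)` is the
  -- indicator of its nonzero coordinates.
  let F : κ → MvPolynomial s (ZMod p) := fun j =>
    ∑ i : s, ((f j i : ℤ) : ZMod p) • MvPolynomial.X i ^ (p - 1)
  have hp1 : p - 1 ≠ 0 := by have := hp.two_le; omega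
  let z : {x : s → ZMod p // ∀ j, MvPolynomial.eval x (F j) = 0} :=
    ⟨0, by simp [F, map_sum, hp1]⟩
  have hdeg : ∑ j, (F j).totalDegree < Fintype.card s := by
    calc ∑ j, (F j).totalDegree ≤ ∑ _j : κ, (p - 1) := by
          refine Finset.sum_le_sum fun j _ => ?_
          refine MvPolynomial.totalDegree_finsetSum_le fun i _ => ?_
          exact (MvPolynomial.totalDegree_smul_le ..).trans (MvPolynomial.totalDegree_X_pow ..).le
      _ < Fintype.card s := by simpa using h
  have hdvd := char_dvd_card_solutions_of_fintype_sum_lt p hdeg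
  obtain ⟨x, hx⟩ := Fintype.exists_ne_of_one_lt_card (hp.one_lt.trans_le
    (Nat.le_of_dvd (Fintype.card_pos_iff.2 ⟨z⟩) hdvd)) z
  refine ⟨(Finset.univ.filter fun i => x.1 i ≠ 0).map ⟨(↑), Subtype.val_injective⟩, ?_, ?_, ?_⟩
  · simp +contextual [Finset.subset_iff]
  · rw [← Subtype.coe_ne_coe, Function.ne_iff] at hx
    obtain ⟨i, hi⟩ := hx
    rw [Finset.map_nonempty]
    exact ⟨i, by simpa [z] using hi⟩
  · intro j
    rw [← ZMod.intCast_zmod_eq_zero_iff_dvd]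
    simpa [F, ZMod.pow_card_sub_one, Finset.sum_filter] using x.2 j

lemma exists_subset_pair_sum_dvd_of_prime {ι : Type*} {p : ℕ} (hp : p.Prime) (s : Finset ι)
    (x y : ι → ℤ) (h : 2 * p - 1 ≤ s.card) :
    ∃ t ⊆ s, t.Nonempty ∧ (p : ℤ) ∣ ∑ i ∈ t, x i ∧ (p : ℤ) ∣ ∑ i ∈ t, y i := by
  obtain ⟨t, hts, ht, hd⟩ := exists_subset_sum_dvd_of_prime (κ := Fin 2) hp s ![x, y] (by
    have := hp.two_le
    rw [Fintype.card_fin]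
    omega)
  exact ⟨t, hts, ht, by simpa using hd 0, by simpa using hd 1⟩

/-- Among `3 * p - 2` pairs there is a nonempty subfamily of length at most `p` whose sum
vanishes modulo the prime `p`. -/
lemma exists_short_subset_pair_sum_dvd {ι : Type*} {p : ℕ} (hp : p.Prime) (s : Finset ι)
    (x y : ι → ℤ) (h : 3 * p - 2 ≤ s.card) :
    ∃ t ⊆ s, t.Nonempty ∧ t.card ≤ p ∧ (p : ℤ) ∣ ∑ i ∈ t, x i ∧ (p : ℤ) ∣ ∑ i ∈ t, y i := by
  classical
  have h2 := hp.two_le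
  obtain ⟨s', hs', hcard⟩ := Finset.exists_subset_card_eq h
  -- The third coordinate forces `p ∣ t.card`, so the length is `p` or `2 * p`.
  obtain ⟨t, hts, ht, hd⟩ := exists_subset_sum_dvd_of_prime (κ := Fin 3) hp s' ![x, y, 1] (by
    rw [Fintype.card_fin]
    omega)
  have hx : (p : ℤ) ∣ ∑ i ∈ t, x i := by simpa using hd 0
  have hy : (p : ℤ) ∣ ∑ i ∈ t, y i := by simpa using hd 1
  have hc : p ∣ t.card := by
    have := hd 2
    simp at this
    exact_mod_cast this
  have htc := Finset.card_le_card hts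
  obtain ⟨c, hc⟩ := hc
  by_cases hc1 : c ≤ 1
  · exact ⟨t, hts.trans hs', ht, by nlinarith, hx, hy⟩
  have hc2 : c = 2 := by
    by_contra hne
    have : 3 ≤ c := by omega
    have : p * 3 ≤ p * c := Nat.mul_le_mul_left _ this
    omega
  subst hc2
  -- Omitting one element yields a proper zero-sum part `v` of `t`; `v` or its complement has length
  -- at most `p`.
  obtain ⟨u, hut, hu⟩ := Finset.exists_subset_card_eq (show 2 * p - 1 ≤ t.card by omega)
  obtain ⟨v, hvu, hv, hvx, hvy⟩ := exists_subset_pair_sum_dvd_of_prime hp u x y hu.ge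
  have hvt := hvu.trans hut
  by_cases hvp : v.card ≤ p
  · exact ⟨v, (hvt.trans hts).trans hs', hv, hvp, hvx, hvy⟩
  have h3 := Finset.card_le_card hvu
  have h4 := Finset.card_sdiff_add_card_eq_card hvt
  refine ⟨t \ v, (Finset.sdiff_subset.trans hts).trans hs', Finset.card_pos.1 (by omega),
    by omega, ?_, ?_⟩
  · rw [← Finset.sum_sdiff hvt] at hx
    exact (dvd_add_left hvx).1 hx
  · rw [← Finset.sum_sdiff hvt] at hy
    exact (dvd_add_left hvy).1 hy

lemma exists_disjoint_blocks {ι : Type*} {p : ℕ} (hp : p.Prime) (x y : ι → ℤ) (k : ℕ) :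
    ∀ s : Finset ι, p * k + 2 * p - 1 ≤ s.card →
      ∃ A : Finset (Finset ι), A.card = k + 1 ∧
        (A : Set (Finset ι)).PairwiseDisjoint id ∧
        ∀ t ∈ A, t ⊆ s ∧ t.Nonempty ∧ (p : ℤ) ∣ ∑ i ∈ t, x i ∧ (p : ℤ) ∣ ∑ i ∈ t, y i := by
  classical
  have h2 := hp.two_le
  induction k with
  | zero =>
    intro s hs
    obtain ⟨t, h⟩ := exists_subset_pair_sum_dvd_of_prime hp s x y (by omega)
    exact ⟨{t}, by simp, by simp, by simpa using h⟩
  | succ k ih =>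
    intro s hs
    rw [mul_add] at hs
    obtain ⟨t, hts, ht, htp, hx, hy⟩ := exists_short_subset_pair_sum_dvd hp s x y (by omega)
    have hc := Finset.card_sdiff_add_card_eq_card hts
    obtain ⟨A, hA, hdis, hsub⟩ := ih (s \ t) (by omega)
    have hd : ∀ u ∈ A, Disjoint t u := fun u hu =>
      Finset.disjoint_sdiff.mono_right (hsub u hu).1
    have htA : t ∉ A := fun h => ht.ne_empty (disjoint_self.1 (hd t h))
    refine ⟨insert t A, by rw [Finset.card_insert_of_notMem htA, hA], ?_, ?_⟩
    · rw [Finset.coe_insert]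
      exact hdis.insert fun u hu _ => hd u hu
    · intro u hu
      rcases Finset.mem_insert.1 hu with rfl | hu
      · exact ⟨hts, ht, hx, hy⟩
      · obtain ⟨h1, h2⟩ := hsub u hu
        exact ⟨h1.trans Finset.sdiff_subset, h2⟩

lemma exists_subset_sum_dvd {ι : Type*} {n : ℕ} (hn : 0 < n) (s : Finset ι) (y : ι → ℤ)
    (h : n ≤ s.card) : ∃ t ⊆ s, t.Nonempty ∧ (n : ℤ) ∣ ∑ i ∈ t, y i := by
  -- Padding with `n - 1` zeros: the `n` selected terms cannot all be padding.
  obtain ⟨t, hts, htc, hd⟩ := Int.erdos_ginzburg_ziv (n := n)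
    (s := s.disjSum (Finset.univ : Finset (Fin (n - 1)))) (Sum.elim y 0) (by simp; omega)
  refine ⟨t.toLeft, fun i hi => ?_, ?_, ?_⟩
  · have := hts (Finset.mem_toLeft.1 hi)
    simpa using this
  · rw [← Finset.card_pos]
    have h1 := Finset.card_toLeft_add_card_toRight (u := t)
    have h2 : t.toRight.card ≤ n - 1 := (Finset.card_le_univ _).trans (by simp)
    omega
  · rw [← Finset.toLeft_disjSum_toRight (u := t), Finset.sum_disjSum] at hd
    simpa using hd

/-- Among `n₁ + n₂ - 1` pairs of integers, where `n₁ ∣ n₂`, a nonempty subfamily has a sum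
that vanishes in `ℤ/n₁ × ℤ/n₂`. -/
theorem exists_subset_pair_sum_dvd (n₁ : ℕ) : ∀ {ι : Type*} (n₂ : ℕ), 0 < n₂ → n₁ ∣ n₂ →
    ∀ (s : Finset ι) (x y : ι → ℤ), n₁ + n₂ - 1 ≤ s.card →
      ∃ t ⊆ s, t.Nonempty ∧ (n₁ : ℤ) ∣ ∑ i ∈ t, x i ∧ (n₂ : ℤ) ∣ ∑ i ∈ t, y i := by
  classical
  induction n₁ using induction_on_primes with
  | zero =>
    intro ι n₂ h0 hd
    rw [zero_dvd_iff] at hd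
    omega
  | one =>
    intro ι n₂ h0 _ s x y hs
    obtain ⟨t, h1, h2, h3⟩ := exists_subset_sum_dvd h0 s y (by omega)
    exact ⟨t, h1, h2, by simp, h3⟩
  | prime_mul p a hp ih =>
    intro ι n₂ h0 hd s x y hs
    obtain ⟨c, rfl⟩ := hd
    rw [mul_assoc] at *
    set b := a * c with hb
    have hb0 : 0 < b := Nat.pos_of_mul_pos_left h0
    have ha0 : 0 < a := Nat.pos_of_mul_pos_right hb0
    -- This gives `a + b - 1` blocks; their sums divided by `p` are a family to which induction
    -- applies, for `a` and `b`.
    obtain ⟨A, hA, hdis, hsub⟩ := exists_disjoint_blocks hp x y (a + b - 2) s (by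
      have : p * (a + b - 2) + 2 * p = p * a + p * b := by
        obtain ⟨k, hk⟩ := Nat.exists_eq_add_of_le (show 2 ≤ a + b by omega)
        rw [← mul_add, hk, Nat.add_sub_cancel_left]
        ring
      omega)
    obtain ⟨B, hBA, hB, hBx, hBy⟩ := ih b hb0 ⟨c, rfl⟩ A (fun t => (∑ i ∈ t, x i) / p)
      (fun t => (∑ i ∈ t, y i) / p) (by omega)
    have hdisB : (B : Set (Finset ι)).PairwiseDisjoint id := hdis.subset hBA
    have key : ∀ (f : ι → ℤ) (m : ℕ), (∀ t ∈ A, (p : ℤ) ∣ ∑ i ∈ t, f i) →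
        (m : ℤ) ∣ ∑ t ∈ B, (∑ i ∈ t, f i) / p → ((p * m : ℕ) : ℤ) ∣ ∑ i ∈ B.biUnion id, f i := by
      intro f m h1 h2
      rw [Finset.sum_biUnion hdisB]
      have : ∑ t ∈ B, ∑ i ∈ id t, f i = p * ∑ t ∈ B, (∑ i ∈ t, f i) / p := by
        rw [Finset.mul_sum]
        exact Finset.sum_congr rfl fun t ht => (Int.mul_ediv_cancel' (h1 t (hBA ht))).symm
      rw [this, Nat.cast_mul]
      exact mul_dvd_mul_left _ h2
    refine ⟨B.biUnion id, Finset.biUnion_subset.2 fun t ht => (hsub t (hBA ht)).1, ?_,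
      key x a (fun t ht => (hsub t ht).2.2.1) hBx, key y b (fun t ht => (hsub t ht).2.2.2) hBy⟩
    obtain ⟨t, ht⟩ := hB
    obtain ⟨i, hi⟩ := (hsub t (hBA ht)).2.1
    exact ⟨i, Finset.mem_biUnion.2 ⟨t, ht, hi⟩⟩

/-! ### The Davenport constant and automatic minimality -/

section Davenport

variable {G : Type*} [AddCommGroup G]

lemma not_isZeroSumFree_of_le_card {n₁ n₂ : ℕ} (h₂ : 0 < n₂) (hd : n₁ ∣ n₂)
    (e : G ≃+ ZMod n₁ × ZMod n₂) (S : Multiset G) (hS : n₁ + n₂ - 1 ≤ S.card) :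
    ¬ IsZeroSumFree S := by
  classical
  intro hfree
  choose x hx using fun i : S => ZMod.intCast_surjective (e i.1).1
  choose y hy using fun i : S => ZMod.intCast_surjective (e i.1).2
  obtain ⟨t, -, ht, htx, hty⟩ := exists_subset_pair_sum_dvd n₁ n₂ h₂ hd
    (Finset.univ : Finset S) x y (by simpa using hS)
  refine hfree (t.val.map fun i : S => i.1) ?_ ?_ ?_
  · calc (t.val.map fun i : S => i.1) ≤ (Finset.univ : Finset S).val.map fun i : S => i.1 :=
        Multiset.map_le_map (Finset.val_le_iff.2 (Finset.subset_univ t))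
      _ = S := Multiset.map_univ_coe S
  · simpa using ht.ne_empty
  · apply e.injective
    change e (∑ i ∈ t, i.1) = e 0
    rw [map_sum, map_zero]
    ext
    · rw [Prod.fst_sum]
      simp only [← hx]
      rw [← Int.cast_sum]
      exact (ZMod.intCast_zmod_eq_zero_iff_dvd _ _).2 htx
    · rw [Prod.snd_sum]
      simp only [← hy]
      rw [← Int.cast_sum]
      exact (ZMod.intCast_zmod_eq_zero_iff_dvd _ _).2 hty

lemma sum_eq_nsmul_add_card_nsmul {u v : G} (B : Multiset G) (hB : ∀ z ∈ B, ∃ x : ℕ, z = x • u + v) :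
    ∃ X : ℕ, B.sum = X • u + B.card • v := by
  induction B using Multiset.induction_on with
  | empty => exact ⟨0, by simp⟩
  | cons z B ih =>
    obtain ⟨X, hX⟩ := ih fun w hw => hB w (Multiset.mem_cons_of_mem hw)
    obtain ⟨x, hx⟩ := hB z (Multiset.mem_cons_self _ _)
    refine ⟨x + X, ?_⟩
    rw [Multiset.sum_cons, Multiset.card_cons, hX, hx, add_nsmul, add_nsmul, one_nsmul]
    abel

lemma IsBasisPair.nsmul_add_nsmul_eq_zero_iff {u v : G} (h : IsBasisPair u v) (r s : ℕ) :
    r • u + s • v = 0 ↔ addOrderOf u ∣ r ∧ addOrderOf v ∣ s := by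
  rw [addOrderOf_dvd_iff_nsmul_eq_zero, addOrderOf_dvd_iff_nsmul_eq_zero]
  constructor
  · intro h'
    simpa using h.2.2.1 r s (by simpa using h')
  · rintro ⟨h1, h2⟩
    rw [h1, h2, add_zero]

/-- A zero-sum subsequence of `u ^ (ord u - 1) * B`, where all terms of `B` lie in `⟨u⟩ + v`, is
either trivial or contains all of `B`. -/
lemma IsBasisPair.eq_zero_or_le_of_sum_eq_zero {u v : G} (h : IsBasisPair u v)
    (hu : 0 < addOrderOf u) {B T : Multiset G} (hB : ∀ z ∈ B, ∃ x : ℕ, z = x • u + v)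
    (hcard : B.card ≤ addOrderOf v) (hT : T ≤ Multiset.replicate (addOrderOf u - 1) u + B)
    (hT0 : T.sum = 0) : T = 0 ∨ (B ≤ T ∧ B.card = addOrderOf v) := by
  classical
  have hdec : T = (T - B) + T ∩ B := (Multiset.sub_add_inter T B).symm
  have h1 : T - B ≤ Multiset.replicate (addOrderOf u - 1) u := Multiset.sub_le_iff_le_add.2 hT
  obtain ⟨j, hj, hjeq⟩ := Multiset.le_replicate_iff.1 h1
  have h2 : T ∩ B ≤ B := Multiset.inter_le_right
  obtain ⟨X, hX⟩ := sum_eq_nsmul_add_card_nsmul (u := u) (v := v) (T ∩ B)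
    fun z hz => hB z (Multiset.mem_of_le h2 hz)
  have hsum : (j + X) • u + (T ∩ B).card • v = 0 := by
    rw [← hT0, hdec, hjeq, Multiset.sum_add, Multiset.sum_replicate, add_nsmul]
    rw [← hjeq, ← hdec, hX, add_assoc]
  obtain ⟨-, hv⟩ := (h.nsmul_add_nsmul_eq_zero_iff _ _).1 hsum
  have hle := Multiset.card_le_card h2
  rcases Nat.eq_zero_or_pos (T ∩ B).card with h0 | h0
  · left
    rw [Multiset.card_eq_zero] at h0
    rw [h0, add_zero, hjeq] at hdec
    rw [hdec, Multiset.sum_replicate, ← addOrderOf_dvd_iff_nsmul_eq_zero] at hT0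
    have : j = 0 := Nat.eq_zero_of_dvd_of_lt hT0 (by omega)
    rw [hdec, this, Multiset.replicate_zero]
  · right
    have := Nat.le_of_dvd h0 hv
    have heq := Multiset.eq_of_le_of_card_le h2 (by omega)
    refine ⟨?_, by omega⟩
    rw [← heq]
    exact Multiset.inter_le_left

lemma davenportConstant_eq {n₁ n₂ : ℕ} (h₂ : 0 < n₂) (hd : n₁ ∣ n₂) (e : G ≃+ ZMod n₁ × ZMod n₂)
    {u v : G} (h : IsBasisPair u v) (hu : 0 < addOrderOf u) (hv : 0 < addOrderOf v)
    (huv : addOrderOf u + addOrderOf v = n₁ + n₂) : davenportConstant G = n₁ + n₂ - 1 := by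
  apply le_antisymm
  · refine Nat.sInf_le ⟨by have := Nat.pos_of_dvd_of_pos hd h₂; omega, fun S hS => ?_⟩
    exact not_isZeroSumFree_of_le_card h₂ hd e S hS
  · refine le_csInf ⟨n₁ + n₂ - 1, by have := Nat.pos_of_dvd_of_pos hd h₂; omega,
      fun S hS => not_isZeroSumFree_of_le_card h₂ hd e S hS⟩ ?_
    rintro l ⟨-, hl⟩
    by_contra! hlt
    refine hl (Multiset.replicate (addOrderOf u - 1) u + Multiset.replicate (addOrderOf v - 1) v)
      (by simp; omega) fun T hT hT0 hsum => ?_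
    rcases h.eq_zero_or_le_of_sum_eq_zero hu (fun z hz => ⟨0, by simp [Multiset.eq_of_mem_replicate hz]⟩)
      (by simp) hT hsum with h1 | ⟨-, h1⟩
    · exact hT0 h1
    · rw [Multiset.card_replicate] at h1
      omega

/-- A nonempty zero-sum subsequence contains all of `B`, so the missing copies of `u` sum to zero;
being fewer than `ord u`, there are none. -/
lemma isMinimalZeroSum_of_sum_eq_zero {u v : G} (h : IsBasisPair u v) (hu : 0 < addOrderOf u)
    (hv : 0 < addOrderOf v)
    {B : Multiset G} (hB : ∀ z ∈ B, ∃ x : ℕ, z = x • u + v) (hcard : B.card = addOrderOf v)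
    (hsum : (Multiset.replicate (addOrderOf u - 1) u + B).sum = 0) :
    IsMinimalZeroSum (Multiset.replicate (addOrderOf u - 1) u + B) := by
  classical
  refine ⟨by simp; omega, hsum, fun T hT _ hTc T' hT' hT0 hs => ?_⟩
  have hle := hT'.trans hT
  rcases h.eq_zero_or_le_of_sum_eq_zero hu hB hcard.le hle hs with h1 | ⟨h1, -⟩
  · exact hT0 h1
  obtain ⟨R, rfl⟩ := Multiset.le_iff_exists_add.1 h1
  rw [add_comm] at hle
  have hR : R ≤ Multiset.replicate (addOrderOf u - 1) u := le_of_add_le_add_right hle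
  obtain ⟨j, hj, rfl⟩ := Multiset.le_replicate_iff.1 hR
  rw [Multiset.sum_add, Multiset.sum_replicate] at hs hsum
  have h2 : (addOrderOf u - 1 - j) • u = 0 := by
    have h3 : (addOrderOf u - 1) • u = (addOrderOf u - 1 - j) • u + j • u := by
      rw [← add_nsmul, Nat.sub_add_cancel hj]
    rw [h3, add_assoc, add_comm (j • u), hs, add_zero] at hsum
    exact hsum
  rw [← addOrderOf_dvd_iff_nsmul_eq_zero] at h2
  have h4 := Nat.eq_zero_of_dvd_of_lt h2 (by omega)
  have h5 := Multiset.card_le_card hT'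
  simp only [Multiset.card_add, Multiset.card_replicate] at h5 hTc
  omega

/-! ### From patterns to a congruence -/

section Pattern

variable {u v : G} {p : ℕ} (a : Fin p → ℕ)

lemma sum_pattern (x : Fin p → ℕ) (m : ℕ) :
    (Multiset.replicate m u + ∑ i, Multiset.replicate (a i) (x i • u + v)).sum =
      (m + ∑ i, a i * x i) • u + (∑ i, a i) • v := by
  rw [Multiset.sum_add, Multiset.sum_replicate, ← Multiset.coe_sumAddMonoidHom, map_sum]
  simp only [Multiset.coe_sumAddMonoidHom, Multiset.sum_replicate, nsmul_add, ← mul_nsmul',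
    Finset.sum_add_distrib, add_nsmul, Finset.sum_nsmul_assoc]
  rw [add_assoc]

lemma card_pattern (x : Fin p → ℕ) (m : ℕ) :
    (Multiset.replicate m u + ∑ i, Multiset.replicate (a i) (x i • u + v)).card =
      m + ∑ i, a i := by
  simp

lemma exists_realizesPattern_iff (h : IsBasisPair u v) (hp : 0 < p) (hu : addOrderOf u = p)
    (hv : 0 < addOrderOf v)
    (hD : davenportConstant G + 1 = p + addOrderOf v) (ha : ∑ i, a i = addOrderOf v) :
    (∃ S : Multiset G, RealizesPattern u v a S) ↔
      ∃ x : Fin p → ℕ, Function.Injective x ∧ (∀ i, x i < p) ∧ ∑ i, a i * x i ≡ 1 [MOD p] := by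
  have key : ∀ x : Fin p → ℕ,
      (Multiset.replicate (addOrderOf u - 1) u +
        ∑ i, Multiset.replicate (a i) (x i • u + v)).sum = 0 ↔ ∑ i, a i * x i ≡ 1 [MOD p] := by
    intro x
    rw [sum_pattern, h.nsmul_add_nsmul_eq_zero_iff, ha, hu]
    simp only [dvd_refl, and_true]
    rw [← Nat.modEq_zero_iff_dvd]
    constructor
    · intro h1
      apply Nat.ModEq.add_left_cancel' (p - 1)
      refine h1.trans ?_
      rw [Nat.sub_add_cancel hp]
      exact (Nat.modEq_zero_iff_dvd.2 dvd_rfl).symm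
    · intro h1
      refine (h1.add_left (p - 1)).trans ?_
      rw [Nat.sub_add_cancel hp]
      exact Nat.modEq_zero_iff_dvd.2 dvd_rfl
  constructor
  · rintro ⟨S, hmin, -, x, hx, hlt, rfl⟩
    exact ⟨x, hx, hu ▸ hlt, (key x).1 hmin.2.1⟩
  · rintro ⟨x, hx, hlt, hmod⟩
    refine ⟨_, isMinimalZeroSum_of_sum_eq_zero h (hu ▸ hp) hv ?_ (by simpa using ha)
      ((key x).2 hmod), ?_, x, hx, hu ▸ hlt, rfl⟩
    · intro z hz
      obtain ⟨i, -, hi⟩ := Multiset.mem_sum.1 hz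
      exact ⟨x i, Multiset.eq_of_mem_replicate hi⟩
    · rw [card_pattern, ha, hu]
      omega

lemma RealizesPattern.card_toFinset [DecidableEq G] {a : Fin p → ℕ} {S : Multiset G}
    (hS : RealizesPattern u v a S) (h : IsBasisPair u v) (hu : 2 ≤ addOrderOf u) :
    S.toFinset.card = (Finset.univ.filter fun i => a i ≠ 0).card + 1 := by
  obtain ⟨-, -, x, hx, hlt, rfl⟩ := hS
  have hset : (Multiset.replicate (addOrderOf u - 1) u +
      ∑ i, Multiset.replicate (a i) (x i • u + v)).toFinset =
      insert u ((Finset.univ.filter fun i => a i ≠ 0).image fun i => x i • u + v) := by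
    ext z
    have h1 : addOrderOf u - 1 ≠ 0 := by omega
    simp only [Multiset.mem_toFinset, Multiset.mem_add, Multiset.mem_replicate, Multiset.mem_sum,
      Finset.mem_insert, Finset.mem_image, Finset.mem_filter, Finset.mem_univ, true_and, ne_eq,
      h1, not_false_eq_true]
    simp only [eq_comm]
  rw [hset, Finset.card_insert_of_notMem, Finset.card_image_of_injective]
  · intro i j hij
    have h1 : x i • u = x j • u := add_right_cancel hij
    exact hx (nsmul_injOn_Iio_addOrderOf (hlt i) (hlt j) h1)
  · intro hmem
    obtain ⟨i, -, hi⟩ := Finset.mem_image.1 hmem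
    have h1 := h.2.2.1 ((x i : ℤ) - 1) 1 (by
      rw [sub_smul, one_smul, one_smul, natCast_zsmul]
      rw [← sub_eq_zero] at hi
      rw [← hi]
      abel)
    exact h.2.1 (by simpa using h1.2)

end Pattern

/-- The images of the standard generators form a basis. -/
lemma exists_isBasisPair {n₁ n₂ : ℕ} (h₁ : 2 ≤ n₁) (h₂ : 2 ≤ n₂) (e : G ≃+ ZMod n₁ × ZMod n₂) :
    ∃ u v : G, IsBasisPair u v ∧ addOrderOf u = n₁ ∧ addOrderOf v = n₂ := by
  have : Fact (1 < n₁) := ⟨h₁⟩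
  have : Fact (1 < n₂) := ⟨h₂⟩
  refine ⟨e.symm (1, 0), e.symm (0, 1), ⟨by simp, by simp, fun r s hrs => ?_, ?_⟩, ?_, ?_⟩
  · rw [← map_zsmul, ← map_zsmul, ← map_add, EmbeddingLike.map_eq_zero_iff] at hrs
    rw [← map_zsmul, ← map_zsmul, EmbeddingLike.map_eq_zero_iff, EmbeddingLike.map_eq_zero_iff]
    simpa [Prod.ext_iff] using hrs
  · rw [eq_top_iff]
    intro g _
    obtain ⟨r, hr⟩ := ZMod.intCast_surjective (e g).1
    obtain ⟨s, hs⟩ := ZMod.intCast_surjective (e g).2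
    rw [AddSubgroup.mem_closure_pair]
    refine ⟨r, s, e.injective ?_⟩
    ext <;> simp [hr, hs]
  · rw [AddEquiv.addOrderOf_eq, Prod.addOrderOf_mk]
    simp
  · rw [AddEquiv.addOrderOf_eq, Prod.addOrderOf_mk]
    simp

end Davenport

/-! ### Unit weightings and gcd conditions -/

/-- Some distinct weights `x i ∈ [0, p - 1]` make the weighted sum of `a` congruent to `1`. -/
def HasUnitWeighting {p : ℕ} (a : Fin p → ℕ) : Prop :=
  ∃ x : Fin p → ℕ, Function.Injective x ∧ (∀ i, x i < p) ∧ ∑ i, a i * x i ≡ 1 [MOD p]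

lemma sum_mul_two_of_injective {p : ℕ} {x : Fin p → ℕ} (hx : Function.Injective x)
    (hlt : ∀ i, x i < p) : (∑ i, x i) * 2 = p * (p - 1) := by
  have himg : Finset.univ.image x = Finset.range p := by
    apply Finset.eq_of_subset_of_card_le
    · intro y hy
      obtain ⟨i, -, rfl⟩ := Finset.mem_image.1 hy
      exact Finset.mem_range.2 (hlt i)
    · rw [Finset.card_image_of_injective _ hx]
      simp
  rw [← Finset.sum_range_id_mul_two, ← himg, Finset.sum_image fun i _ j _ h => hx h]

lemma dvd_patternGcd_iff {p k : ℕ} {a : Fin p → ℕ} :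
    k ∣ patternGcd a ↔ (∀ i, k ∣ a i) ∧ k ∣ p := by
  simp [patternGcd, Nat.dvd_gcd_iff, Finset.dvd_gcd_iff]

lemma dvd_patternDiffGcd_iff {p k : ℕ} {a : Fin p → ℕ} :
    k ∣ patternDiffGcd a ↔ (∀ i j, a i ≡ a j [MOD k]) ∧ k ∣ p := by
  rw [patternDiffGcd, Nat.dvd_gcd_iff, Finset.dvd_gcd_iff]
  refine and_congr_left fun _ => ⟨fun h i j => ?_, fun h q _ => ?_⟩
  · have := h (j, i) (Finset.mem_univ _)
    rw [← Int.natCast_dvd] at this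
    exact Nat.modEq_iff_dvd.2 this
  · rw [← Int.natCast_dvd]
    exact Nat.modEq_iff_dvd.1 (h q.2 q.1)

lemma HasUnitWeighting.patternGcd_eq_one {p : ℕ} {a : Fin p → ℕ} (h : HasUnitWeighting a) :
    patternGcd a = 1 := by
  obtain ⟨x, -, -, hmod⟩ := h
  obtain ⟨h1, h2⟩ := dvd_patternGcd_iff.1 (dvd_refl (patternGcd a))
  have h3 : patternGcd a ∣ ∑ i, a i * x i := Finset.dvd_sum fun i _ => (h1 i).mul_right _
  exact Nat.dvd_one.1 (((hmod.of_dvd h2).dvd_iff dvd_rfl).1 h3)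

/-- The rearrangement theorem handles the primes of the first kind; the second alternative is for `ℓ
= 2` with all entries odd. -/
lemma hasUnitWeighting_of_primes {p : ℕ} (hp : 2 ≤ p) (a : Fin p → ℕ)
    (h : ∀ ℓ : ℕ, ℓ.Prime → ℓ ∣ p → (∃ i j, ¬ a i ≡ a j [MOD ℓ]) ∨
      ∀ σ : Equiv.Perm (Fin p), ¬ ℓ ∣ ∑ i, a (σ i) * (i : ℕ)) : HasUnitWeighting a := by
  classical
  obtain ⟨σ, hσ⟩ := exists_perm_sum_mul_not_dvd
    (p.primeFactors.filter fun ℓ => ∃ i j, ¬ a i ≡ a j [MOD ℓ])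
    (fun ℓ hℓ => Nat.prime_of_mem_primeFactors (Finset.mem_filter.1 hℓ).1) p (by omega)
    (fun ℓ hℓ => Nat.dvd_of_mem_primeFactors (Finset.mem_filter.1 hℓ).1) (fun i => a i)
    (fun ℓ hℓ => by
      obtain ⟨i, j, hij⟩ := (Finset.mem_filter.1 hℓ).2
      exact ⟨i, j, by rwa [Int.natCast_modEq_iff]⟩)
  refine exists_injective_sum_modEq_one hp a σ fun ℓ hℓ hℓp => ?_
  rcases h ℓ hℓ hℓp with h1 | h1
  · have := hσ ℓ (Finset.mem_filter.2 ⟨Nat.mem_primeFactors.2 ⟨hℓ, hℓp, by omega⟩, h1⟩)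
    exact_mod_cast this
  · exact h1 σ

lemma hasUnitWeighting_of_patternDiffGcd_eq_one {p : ℕ} (hp : 2 ≤ p) {a : Fin p → ℕ}
    (h : patternDiffGcd a = 1) : HasUnitWeighting a := by
  refine hasUnitWeighting_of_primes hp a fun ℓ hℓ hℓp => Or.inl ?_
  by_contra! hc
  have := dvd_patternDiffGcd_iff.2 ⟨hc, hℓp⟩
  rw [h, Nat.dvd_one] at this
  exact hℓ.ne_one this

lemma patternDiffGcd_dvd_patternGcd {p : ℕ} {a : Fin p → ℕ} (h0 : ∃ i, a i = 0) :
    patternDiffGcd a ∣ patternGcd a := by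
  obtain ⟨i, hi⟩ := h0
  obtain ⟨h1, h2⟩ := dvd_patternDiffGcd_iff.1 (dvd_refl (patternDiffGcd a))
  exact dvd_patternGcd_iff.2 ⟨fun j => Nat.modEq_zero_iff_dvd.1 (hi ▸ h1 j i), h2⟩

/-- Patterns with a zero entry. -/
lemma hasUnitWeighting_iff_of_exists_zero {p : ℕ} (hp : 2 ≤ p) {a : Fin p → ℕ}
    (h0 : ∃ i, a i = 0) : HasUnitWeighting a ↔ patternGcd a = 1 := by
  refine ⟨fun h => h.patternGcd_eq_one, fun h => ?_⟩
  have := patternDiffGcd_dvd_patternGcd h0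
  rw [h, Nat.dvd_one] at this
  exact hasUnitWeighting_of_patternDiffGcd_eq_one hp this

lemma HasUnitWeighting.eq_two_of_forall_eq_one {p : ℕ} (hp : 2 ≤ p) {a : Fin p → ℕ}
    (h : HasUnitWeighting a) (ha : ∀ i, a i = 1) : p = 2 := by
  obtain ⟨x, hx, hlt, hmod⟩ := h
  simp only [ha, one_mul] at hmod
  have h2 := sum_mul_two_of_injective hx hlt
  have h3 : (∑ i, x i) * 2 ≡ 1 * 2 [MOD p] := hmod.mul_right 2
  rw [h2] at h3
  have h4 := ((Nat.ModEq.dvd_iff h3 dvd_rfl).1 (dvd_mul_right _ _))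
  exact le_antisymm (Nat.le_of_dvd two_pos h4) hp

lemma hasUnitWeighting_fin_two_iff {a : Fin 2 → ℕ} (ha : Even (∑ i, a i)) :
    HasUnitWeighting a ↔ ∀ i, Odd (a i) := by
  rw [Fin.sum_univ_two] at ha
  constructor
  · rintro ⟨x, -, -, hmod⟩
    have hodd : Odd (∑ i, a i * x i) := Nat.odd_iff.2 hmod
    rw [Fin.sum_univ_two] at hodd
    have h2 : Odd (a 0) ∨ Odd (a 1) := by
      by_contra! hc
      simp only [Nat.not_odd_iff_even] at hc
      exact Nat.not_even_iff_odd.2 hodd ((hc.1.mul_right _).add (hc.2.mul_right _))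
    rw [Fin.forall_fin_two]
    rw [Nat.even_add] at ha
    simp only [← Nat.not_even_iff_odd] at *
    tauto
  · intro h
    refine ⟨fun i => i, Fin.val_injective, fun i => i.2, ?_⟩
    rw [Fin.sum_univ_two]
    simpa [Nat.ModEq] using Nat.odd_iff.1 (h 1)

/-- For weights running through all residues, a sum with odd coefficients is congruent modulo
`2` to the plain sum of the weights. -/
lemma sum_mul_modEq_sum_of_odd {p : ℕ} {a x : Fin p → ℕ} (ha : ∀ i, Odd (a i)) :
    ∑ i, a i * x i ≡ ∑ i, x i [MOD 2] := by
  refine Nat.ModEq.sum fun i _ => ?_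
  have : a i ≡ 1 [MOD 2] := Nat.odd_iff.1 (ha i)
  simpa using this.mul_right (x i)

lemma odd_sum_iff_mod_four_eq_two {p : ℕ} (hp : Even p) {x : Fin p → ℕ}
    (hx : Function.Injective x) (hlt : ∀ i, x i < p) : Odd (∑ i, x i) ↔ p % 4 = 2 := by
  have h := sum_mul_two_of_injective hx hlt
  obtain ⟨m, rfl⟩ := hp
  rcases Nat.eq_zero_or_pos m with rfl | hm
  · simp
  have h2 : ∑ i, x i = m * (2 * (m - 1) + 1) := by
    apply Nat.eq_of_mul_eq_mul_right two_pos
    rw [h, show m + m - 1 = 2 * (m - 1) + 1 by omega]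
    ring
  rw [h2, Nat.odd_mul]
  have : Odd (2 * (m - 1) + 1) := odd_two_mul_add_one _
  simp only [this, and_true]
  rw [Nat.odd_iff]
  omega

/-- Existence of unit weightings in terms of the gcd of the differences. -/
lemma hasUnitWeighting_iff_patternDiffGcd {p : ℕ} (hp : 2 ≤ p) {a : Fin p → ℕ} :
    HasUnitWeighting a ↔
      ((Odd p ∨ ∃ i, Even (a i)) ∧ patternDiffGcd a = 1) ∨
        (p % 4 = 2 ∧ (∀ i, Odd (a i)) ∧ patternDiffGcd a = 2) := by
  constructor
  · rintro ⟨x, hx, hlt, hmod⟩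
    obtain ⟨hd1, hd2⟩ := dvd_patternDiffGcd_iff.1 (dvd_refl (patternDiffGcd a))
    -- Modulo the gcd all entries agree, so twice the weighted sum is a multiple of `p * (p - 1)`,
    -- hence `0 ≡ 2`.
    have hdvd : patternDiffGcd a ∣ 2 := by
      have h1 : ∑ i, a i * x i ≡ ∑ i, a ⟨0, by omega⟩ * x i [MOD patternDiffGcd a] :=
        Nat.ModEq.sum fun i _ => (hd1 i _).mul_right _
      have h2 := (((hmod.of_dvd hd2).symm.trans h1).mul_right 2)
      rw [← Finset.mul_sum, mul_assoc, sum_mul_two_of_injective hx hlt] at h2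
      exact (Nat.ModEq.dvd_iff h2 dvd_rfl).2 ((hd2.mul_right _).mul_left _)
    rcases (Nat.dvd_prime Nat.prime_two).1 hdvd with h1 | h2
    · refine Or.inl ⟨?_, h1⟩
      by_contra! hc
      obtain ⟨hpe, hodd⟩ := hc
      rw [Nat.not_odd_iff_even] at hpe
      have : 2 ∣ patternDiffGcd a := dvd_patternDiffGcd_iff.2 ⟨fun i j => by
        have hi := Nat.odd_iff.1 (Nat.not_even_iff_odd.1 (hodd i))
        have hj := Nat.odd_iff.1 (Nat.not_even_iff_odd.1 (hodd j))
        exact hi.trans hj.symm, hpe.two_dvd⟩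
      omega
    · rw [h2] at hd1 hd2
      have hmod2 : Odd (∑ i, a i * x i) := Nat.odd_iff.2 (hmod.of_dvd hd2)
      have hodd : ∀ i, Odd (a i) := by
        by_contra! hc
        obtain ⟨i, hi⟩ := hc
        rw [Nat.not_odd_iff_even] at hi
        refine Nat.not_even_iff_odd.2 hmod2 (Finset.even_sum _ fun j _ => Even.mul_right ?_ _)
        rw [Nat.even_iff] at hi ⊢
        exact (show a j % 2 = a i % 2 from hd1 j i).trans hi
      refine Or.inr ⟨?_, hodd, h2⟩
      rw [← odd_sum_iff_mod_four_eq_two (even_iff_two_dvd.2 hd2) hx hlt, Nat.odd_iff]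
      exact (show _ % 2 = _ % 2 from (sum_mul_modEq_sum_of_odd hodd).symm).trans (Nat.odd_iff.1 hmod2)
  · rintro (⟨-, h⟩ | ⟨h4, hodd, h2⟩)
    · exact hasUnitWeighting_of_patternDiffGcd_eq_one hp h
    · refine hasUnitWeighting_of_primes hp a fun ℓ hℓ hℓp => ?_
      by_cases hℓ2 : ℓ = 2
      · subst hℓ2
        right
        intro σ hdiv
        have h5 := (odd_sum_iff_mod_four_eq_two (even_iff_two_dvd.2 hℓp) Fin.val_injective
          (fun i => i.2)).2 h4
        have h6 := sum_mul_modEq_sum_of_odd (a := fun i => a (σ i)) (x := fun i : Fin p => (i : ℕ))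
          fun i => hodd (σ i)
        have h7 := (Nat.ModEq.dvd_iff h6 dvd_rfl).1 hdiv
        exact Nat.not_even_iff_odd.2 h5 (even_iff_two_dvd.2 h7)
      · left
        by_contra! hc
        have := dvd_patternDiffGcd_iff.2 ⟨hc, hℓp⟩
        rw [h2] at this
        exact hℓ2 ((Nat.prime_dvd_prime_iff_eq hℓ Nat.prime_two).1 this)

/-! ### Numbers of distinct terms -/

section Support

variable {p q : ℕ}

lemma card_support_le_sum (a : Fin p → ℕ) :
    (Finset.univ.filter fun i => a i ≠ 0).card ≤ ∑ i, a i := by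
  rw [Finset.card_filter]
  exact Finset.sum_le_sum fun i _ => by split_ifs <;> omega

lemma card_support_le (a : Fin p → ℕ) : (Finset.univ.filter fun i => a i ≠ 0).card ≤ p :=
  (Finset.card_le_univ _).trans (by simp)

/-- Nonzero entries summing to their number are all `1`. -/
lemma forall_eq_one_of_sum_eq {a : Fin p → ℕ} (ha : ∑ i, a i = p) (h0 : ¬ ∃ i, a i = 0) (i : Fin p) :
    a i = 1 := by
  have h1 : ∀ i ∈ Finset.univ, 1 ≤ a i := fun i _ =>
    Nat.one_le_iff_ne_zero.2 fun h => h0 ⟨i, h⟩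
  exact ((Finset.sum_eq_sum_iff_of_le h1).1 (by simp [ha]) i (Finset.mem_univ i)).symm

lemma card_support_lt {a : Fin p → ℕ} (h0 : ∃ i, a i = 0) :
    (Finset.univ.filter fun i => a i ≠ 0).card < p := by
  obtain ⟨i, hi⟩ := h0
  have : (Finset.univ.filter fun i => a i ≠ 0).card < (Finset.univ : Finset (Fin p)).card :=
    Finset.card_lt_card (Finset.filter_ssubset.2 ⟨i, Finset.mem_univ _, by simpa using hi⟩)
  simpa using this

/-- A single positive entry would equal `q`, and `r` would divide `patternGcd a = 1`. -/
lemma HasUnitWeighting.two_le_card_support {a : Fin p → ℕ} (h : HasUnitWeighting a)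
    (hsum : ∑ i, a i = q) {r : ℕ} (hr : 2 ≤ r) (hrp : r ∣ p) (hrq : r ∣ q) :
    2 ≤ (Finset.univ.filter fun i => a i ≠ 0).card := by
  by_contra! hc
  have hall : ∀ i, r ∣ a i := by
    intro i
    by_cases hi : a i = 0
    · rw [hi]; exact dvd_zero _
    have hother : ∀ j, j ≠ i → a j = 0 := by
      intro j hj
      by_contra hj0
      exact hj (Finset.card_le_one.1 (Nat.lt_succ_iff.1 hc) j (by simpa using hj0) i
        (by simpa using hi))
    rw [← Finset.sum_eq_single_of_mem i (Finset.mem_univ i) (fun j _ hj => hother j hj), hsum]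
    exact hrq
  have := dvd_patternGcd_iff.2 ⟨hall, hrp⟩
  rw [h.patternGcd_eq_one, Nat.dvd_one] at this
  omega

lemma patternGcd_eq_one_of_eq_one {a : Fin p → ℕ} (h : ∃ i, a i = 1) : patternGcd a = 1 := by
  obtain ⟨i, hi⟩ := h
  have := (dvd_patternGcd_iff.1 (dvd_refl (patternGcd a))).1 i
  rwa [hi, Nat.dvd_one] at this

/-- A pattern with `t` positive entries, one of which is `1`, and a zero entry if `t < p`. -/
lemma exists_pattern_card_support {t : ℕ} (ht : 2 ≤ t) (htp : t < p) (htq : t ≤ q) :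
    ∃ a : Fin p → ℕ, ∑ i, a i = q ∧ (Finset.univ.filter fun i => a i ≠ 0).card = t ∧
      HasUnitWeighting a := by
  have hcard : (Finset.univ.filter fun i : Fin p => (i : ℕ) < t).card = t := by
    rw [Fin.card_filter_val_lt]
    omega
  -- The pattern `(q - t + 1, 1, …, 1, 0, …, 0)`.
  let a : Fin p → ℕ := fun i =>
    (if i = ⟨0, by omega⟩ then q - t else 0) + (if (i : ℕ) < t then 1 else 0)
  have h0 : a ⟨t, htp⟩ = 0 := by simp [a, Fin.ext_iff]; omega
  have h1 : a ⟨1, by omega⟩ = 1 := by simp [a, Fin.ext_iff]; omega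
  refine ⟨a, ?_, ?_, (hasUnitWeighting_iff_of_exists_zero (by omega) ⟨_, h0⟩).2
    (patternGcd_eq_one_of_eq_one ⟨_, h1⟩)⟩
  · simp only [a, Finset.sum_add_distrib, Finset.sum_ite_eq', Finset.mem_univ, if_true]
    rw [← Finset.card_filter, hcard]
    omega
  · rw [← hcard]
    congr 1
    ext i
    simp only [a, Finset.mem_filter, Finset.mem_univ, true_and, Fin.ext_iff]
    split_ifs <;> omega

/-- A pattern without zero entries. -/
lemma exists_pattern_full_support (hp : 3 ≤ p) (hq : p < q) :
    ∃ a : Fin p → ℕ, ∑ i, a i = q ∧ (Finset.univ.filter fun i => a i ≠ 0).card = p ∧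
      HasUnitWeighting a := by
  -- The pattern `(q - p, 2, 1, …, 1)`, where `2 - 1` makes the gcd of differences `1`.
  let a : Fin p → ℕ := fun i =>
    1 + (if i = ⟨0, by omega⟩ then q - p - 1 else 0) + (if i = ⟨1, by omega⟩ then 1 else 0)
  have h1 : a ⟨1, by omega⟩ = 2 := by simp [a, Fin.ext_iff]
  have h2 : a ⟨2, by omega⟩ = 1 := by simp [a, Fin.ext_iff]
  refine ⟨a, ?_, ?_, hasUnitWeighting_of_patternDiffGcd_eq_one (by omega) ?_⟩
  · simp only [a, Finset.sum_add_distrib, Finset.sum_ite_eq', Finset.mem_univ, if_true,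
      Finset.sum_const, Finset.card_univ, Fintype.card_fin, smul_eq_mul]
    omega
  · rw [Finset.filter_true_of_mem]
    · simp
    · intro i _
      simp only [a]
      omega
  · have h3 := (dvd_patternDiffGcd_iff.1 (dvd_refl (patternDiffGcd a))).1 ⟨2, by omega⟩ ⟨1, by omega⟩
    rw [h1, h2] at h3
    exact Nat.dvd_one.1 ((Nat.modEq_iff_dvd' (by norm_num)).1 h3)

end Support

lemma exists_pattern_fin_two {q : ℕ} (hq : 2 ≤ q) (he : Even q) :
    ∃ a : Fin 2 → ℕ, ∑ i, a i = q ∧ (Finset.univ.filter fun i => a i ≠ 0).card = 2 ∧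
      HasUnitWeighting a := by
  have hsum : ∑ i, ![1, q - 1] i = q := by
    rw [Fin.sum_univ_two]
    simp
    omega
  have hodd : ∀ i, Odd (![1, q - 1] i) := by
    rw [Fin.forall_fin_two]
    refine ⟨by simp, ?_⟩
    simpa using Nat.Even.sub_odd (by omega) he odd_one
  refine ⟨![1, q - 1], hsum, ?_, (hasUnitWeighting_fin_two_iff (hsum.symm ▸ he)).2 hodd⟩
  rw [Finset.filter_true_of_mem]
  · simp
  · intro i _ h0
    simpa [h0] using hodd i

section Counting

variable {G : Type*} [AddCommGroup G] [DecidableEq G] {u v : G} {p q : ℕ}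

/-- The possible numbers of distinct terms, in terms of the admissible patterns. -/
lemma exists_realizesPattern_card_iff (h : IsBasisPair u v) (hp : 2 ≤ p) (hq : 2 ≤ q)
    (hu : addOrderOf u = p) (hv : addOrderOf v = q) (hD : davenportConstant G + 1 = p + q) (k : ℕ) :
    (∃ a : Fin p → ℕ, ∑ i, a i = q ∧ ∃ S : Multiset G, RealizesPattern u v a S ∧
      S.toFinset.card = k) ↔
    ∃ a : Fin p → ℕ, ∑ i, a i = q ∧ HasUnitWeighting a ∧
      (Finset.univ.filter fun i => a i ≠ 0).card + 1 = k := by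
  refine exists_congr fun a => and_congr_right fun ha => ?_
  have hiff : (∃ S : Multiset G, RealizesPattern u v a S) ↔ HasUnitWeighting a :=
    exists_realizesPattern_iff a h (by omega) hu (by omega) (by omega) (by omega)
  constructor
  · rintro ⟨S, hS, rfl⟩
    exact ⟨hiff.1 ⟨S, hS⟩, (hS.card_toFinset h (by omega)).symm⟩
  · rintro ⟨hw, rfl⟩
    obtain ⟨S, hS⟩ := hiff.2 hw
    exact ⟨S, hS, hS.card_toFinset h (by omega)⟩

end Counting

lemma card_support_add_one_iff_of_eq {n : ℕ} (hn : 2 ≤ n) (k : ℕ) :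
    (∃ a : Fin n → ℕ, ∑ i, a i = n ∧ HasUnitWeighting a ∧
      (Finset.univ.filter fun i => a i ≠ 0).card + 1 = k) ↔
      3 ≤ k ∧ (k ≤ n ∨ (n = 2 ∧ k = n + 1)) := by
  constructor
  · rintro ⟨a, ha, hw, rfl⟩
    have h1 := hw.two_le_card_support ha hn dvd_rfl dvd_rfl
    refine ⟨by omega, ?_⟩
    by_cases h0 : ∃ i, a i = 0
    · exact Or.inl (card_support_lt h0)
    · have h2 := hw.eq_two_of_forall_eq_one hn (forall_eq_one_of_sum_eq ha h0)
      have := card_support_le a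
      omega
  · rintro ⟨h3, h | ⟨rfl, rfl⟩⟩
    · obtain ⟨a, h4, h5, h6⟩ := exists_pattern_card_support (p := n) (q := n) (t := k - 1)
        (by omega) (by omega) (by omega)
      exact ⟨a, h4, h6, by omega⟩
    · obtain ⟨a, h4, h5, h6⟩ := exists_pattern_fin_two le_rfl even_two
      exact ⟨a, h4, h6, by omega⟩

lemma card_support_add_one_iff_of_lt {p q : ℕ} (hq : 2 ≤ q) (hqp : q < p) (hd : q ∣ p) (k : ℕ) :
    (∃ a : Fin p → ℕ, ∑ i, a i = q ∧ HasUnitWeighting a ∧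
      (Finset.univ.filter fun i => a i ≠ 0).card + 1 = k) ↔ 3 ≤ k ∧ k ≤ q + 1 := by
  constructor
  · rintro ⟨a, ha, hw, rfl⟩
    have h1 := hw.two_le_card_support ha hq hd dvd_rfl
    have h2 := card_support_le_sum a
    omega
  · rintro ⟨h3, h4⟩
    obtain ⟨a, h5, h6, h7⟩ := exists_pattern_card_support (p := p) (q := q) (t := k - 1)
      (by omega) (by omega) (by omega)
    exact ⟨a, h5, h7, by omega⟩

lemma card_support_add_one_iff_of_gt {p q : ℕ} (hp : 2 ≤ p) (hpq : p < q) (hd : p ∣ q) (k : ℕ) :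
    (∃ a : Fin p → ℕ, ∑ i, a i = q ∧ HasUnitWeighting a ∧
      (Finset.univ.filter fun i => a i ≠ 0).card + 1 = k) ↔ 3 ≤ k ∧ k ≤ p + 1 := by
  constructor
  · rintro ⟨a, ha, hw, rfl⟩
    have h1 := hw.two_le_card_support ha hp dvd_rfl hd
    have h2 := card_support_le a
    omega
  · rintro ⟨h3, h4⟩
    obtain ⟨a, h5, h6, h7⟩ : ∃ a : Fin p → ℕ, ∑ i, a i = q ∧
        (Finset.univ.filter fun i => a i ≠ 0).card = k - 1 ∧ HasUnitWeighting a := by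
      by_cases hk : k - 1 < p
      · exact exists_pattern_card_support (by omega) hk (by omega)
      have hk' : k - 1 = p := by omega
      rw [hk']
      by_cases hp2 : p = 2
      · subst hp2
        exact exists_pattern_fin_two hpq.le (even_iff_two_dvd.2 hd)
      · exact exists_pattern_full_support (by omega) hpq
    exact ⟨a, h5, h7, by omega⟩

/-! ### The main theorem -/

theorem mainTheorem4 {G : Type*} [AddCommGroup G] [Finite G] [DecidableEq G] (n₁ n₂ : ℕ)
    (h₁ : 2 ≤ n₁) (hdvd : n₁ ∣ n₂) (hG : Nonempty (G ≃+ ZMod n₁ × ZMod n₂)) :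
    -- all support sizes in the stated range occur
    (∀ k : ℕ, 3 ≤ k → k ≤ min (n₁ + 1) (AddMonoid.exponent G) →
      ∃ S : Multiset G, IsMinimalZeroSum S ∧ S.card = davenportConstant G ∧
        S.toFinset.card = k) ∧
    -- equal orders
    (n₁ = n₂ → ∀ u v : G, IsBasisPair u v → addOrderOf u = n₁ → addOrderOf v = n₁ →
      (∀ a : Fin n₁ → ℕ, ∑ i, a i = n₁ →
        ((∃ S : Multiset G, RealizesPattern u v a S) ↔
          (n₁ = 2 ∧ ∀ i, a i = 1) ∨ ((∃ i, a i = 0) ∧ patternGcd a = 1))) ∧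
      (∀ k : ℕ,
        (∃ a : Fin n₁ → ℕ, ∑ i, a i = n₁ ∧
          ∃ S : Multiset G, RealizesPattern u v a S ∧ S.toFinset.card = k) ↔
          3 ≤ k ∧ (k ≤ n₁ ∨ (n₁ = 2 ∧ k = n₁ + 1)))) ∧
    -- the element of multiplicity `ord u - 1` has the larger order
    (n₁ < n₂ → ∀ u v : G, IsBasisPair u v → addOrderOf u = n₂ → addOrderOf v = n₁ →
      (∀ a : Fin n₂ → ℕ, ∑ i, a i = n₁ →
        ((∃ S : Multiset G, RealizesPattern u v a S) ↔ patternGcd a = 1)) ∧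
      (∀ k : ℕ,
        (∃ a : Fin n₂ → ℕ, ∑ i, a i = n₁ ∧
          ∃ S : Multiset G, RealizesPattern u v a S ∧ S.toFinset.card = k) ↔
          3 ≤ k ∧ k ≤ n₁ + 1)) ∧
    -- the element of multiplicity `ord u - 1` has the smaller order
    (n₁ < n₂ → ∀ u v : G, IsBasisPair u v → addOrderOf u = n₁ → addOrderOf v = n₂ →
      (∀ a : Fin n₁ → ℕ, ∑ i, a i = n₂ →
        (n₁ = 2 → ((∃ S : Multiset G, RealizesPattern u v a S) ↔ ∀ i, Odd (a i))) ∧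
        (3 ≤ n₁ → ((∃ S : Multiset G, RealizesPattern u v a S) ↔
          ((Odd n₁ ∨ ∃ i, Even (a i)) ∧ patternDiffGcd a = 1) ∨
          (n₁ % 4 = 2 ∧ (∀ i, Odd (a i)) ∧ patternDiffGcd a = 2)))) ∧
      (∀ k : ℕ,
        (∃ a : Fin n₁ → ℕ, ∑ i, a i = n₂ ∧
          ∃ S : Multiset G, RealizesPattern u v a S ∧ S.toFinset.card = k) ↔
          3 ≤ k ∧ k ≤ n₁ + 1)) := by
  obtain ⟨e⟩ := hG
  have hn₂ : 0 < n₂ := by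
    rcases Nat.eq_zero_or_pos n₂ with rfl | h
    · exact absurd (Finite.of_injective (fun z : ZMod 0 => e.symm (0, z))
        fun x y h => by simpa using h) (not_finite_iff_infinite.2 (inferInstanceAs (Infinite ℤ)))
    · exact h
  have hle : n₁ ≤ n₂ := Nat.le_of_dvd hn₂ hdvd
  obtain ⟨u₀, v₀, hb₀, hu₀, hv₀⟩ := exists_isBasisPair h₁ (h₁.trans hle) e
  have hD : davenportConstant G + 1 = n₁ + n₂ := by
    rw [davenportConstant_eq hn₂ hdvd e hb₀ (by omega) (by omega) (by omega)]
    omega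
  have hreal : ∀ {p q : ℕ} {u v : G}, IsBasisPair u v → addOrderOf u = p → addOrderOf v = q →
      2 ≤ p → 2 ≤ q → n₁ + n₂ = p + q → ∀ a : Fin p → ℕ, ∑ i, a i = q →
      ((∃ S : Multiset G, RealizesPattern u v a S) ↔ HasUnitWeighting a) :=
    fun h hu hv hp hq hpq a ha =>
      exists_realizesPattern_iff a h (by omega) hu (by omega) (by omega) (by omega)
  refine ⟨fun k hk hk' => ?_, ?_, ?_, ?_⟩
  · have hexp : AddMonoid.exponent G ≤ n₂ := by
      refine Nat.le_of_dvd hn₂ (AddMonoid.exponent_dvd_of_forall_nsmul_eq_zero fun g => ?_)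
      apply e.injective
      rw [map_nsmul, map_zero]
      ext
      · obtain ⟨c, rfl⟩ := hdvd
        simp
      · simp
    obtain ⟨a, -, S, hS, hcard⟩ := (exists_realizesPattern_card_iff hb₀ h₁ (by omega) hu₀ hv₀ hD k).2 (by
      rcases hle.eq_or_lt with rfl | hlt
      · exact (card_support_add_one_iff_of_eq h₁ k).2 ⟨hk, Or.inl (by omega)⟩
      · exact (card_support_add_one_iff_of_gt h₁ hlt hdvd k).2 ⟨hk, by omega⟩)
    exact ⟨S, hS.1, hS.2.1, hcard⟩
  · rintro rfl u v hb hu hv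
    refine ⟨fun a ha => ?_, fun k => ?_⟩
    · rw [hreal hb hu hv h₁ h₁ rfl a ha]
      constructor
      · intro hw
        by_cases h0 : ∃ i, a i = 0
        · exact Or.inr ⟨h0, hw.patternGcd_eq_one⟩
        · have h1 := forall_eq_one_of_sum_eq ha h0
          exact Or.inl ⟨hw.eq_two_of_forall_eq_one h₁ h1, h1⟩
      · rintro (⟨rfl, h1⟩ | ⟨h0, hg⟩)
        · exact (hasUnitWeighting_fin_two_iff (by rw [ha]; exact even_two)).2 fun i => by simp [h1 i]
        · exact (hasUnitWeighting_iff_of_exists_zero h₁ h0).2 hg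
    · rw [exists_realizesPattern_card_iff hb h₁ h₁ hu hv hD]
      exact card_support_add_one_iff_of_eq h₁ k
  · intro hlt u v hb hu hv
    refine ⟨fun a ha => ?_, fun k => ?_⟩
    · rw [hreal hb hu hv (by omega) h₁ (by omega) a ha]
      refine hasUnitWeighting_iff_of_exists_zero (by omega) ?_
      -- `p = n₂` entries with sum `n₁ < n₂` cannot all be positive.
      by_contra! hc
      have h1 := card_support_le_sum a
      rw [Finset.filter_true_of_mem fun i _ => hc i, ha] at h1
      simp at h1
      omega
    · rw [exists_realizesPattern_card_iff hb (by omega) h₁ hu hv (by omega)]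
      exact card_support_add_one_iff_of_lt h₁ hlt hdvd k
  · intro hlt u v hb hu hv
    refine ⟨fun a ha => ?_, fun k => ?_⟩
    · rw [hreal hb hu hv h₁ (by omega) rfl a ha]
      refine ⟨?_, fun _ => hasUnitWeighting_iff_patternDiffGcd h₁⟩
      rintro rfl
      exact hasUnitWeighting_fin_two_iff (ha ▸ even_iff_two_dvd.2 hdvd)
    · rw [exists_realizesPattern_card_iff hb h₁ (by omega) hu hv hD]
      exact card_support_add_one_iff_of_gt h₁ hlt hdvd k
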